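/- Let $n\ge 0$, $[n]=\{1,\dots,n\}$, and let $X=(x_{i,j})_{1\le i,j\le n}$ be a matrix of $n^2$ independent variables over $\mathbb{Q}$. For $k\ge 0$ let $C_k(X)=(c_{S,T})$ be its $k$-th compound matrix over the field $\mathbb{Q}(x_{i,j})$: rows and columns are indexed by the $k$-subsets of $[n]$, and $c_{S,T}=\det (x_{i,j})_{i\in S,\,j\in T}$. For families $F_1,F_2\subseteq\binom{[n]}{k}$, say that $F_1$ *dominates* $F_2$ if the submatrix of $C_k(X)$ with rows indexed by $F_2$ and columns indexed by $F_1$ has rank $|F_2|$, and that $F_1$ and $F_2$ are *weakly isomorphic* if each dominates the other. A *term order* $<_t$ on $\binom{[n]}{k}$ is a linear order extending the componentwise partial order, in which $\{s_1<\dots<s_k\}\le\{t_1<\dots<t_k\}$ iff $s_i\le t_i$ for all $i$. For $F\subseteq\binom{[n]}{k}$, the *exterior shifting* $F^{<_t}$ is the $<_t$-smallest family among all $H\subseteq\binom{[n]}{k}$ with $|H|=|F|$ that are weakly isomorphic to $F$; here, for distinct families $Y,Z$ of the same size, $Y$ is $<_t$-smaller than $Z$ if the $<_t$-least element of the symmetric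 difference $Y\triangle Z$ belongs to $Y$. (Such a smallest family exists and is unique.) Let $B(n)=\{ab : 1\le a<b\le n,\ a+b\le n\}$, where $ab$ denotes $\{a,b\}$. **Theorem.** Let $G$ be a simple graph on the vertex set $[n]$ such that every $3$-subset of $[n]$ contains an edge of $G$. Then: 1. the edge set $E(G)$ dominates $B(n)$; 2. for every term order $<_t$ on $\binom{[n]}{2}$ such that $ab<_t a'b'$ whenever $a+b<a'+b'$ (with $a<b$, $a'<b'$), the exterior shifting $E(G)^{<_t}$ contains $B(n)$. -/

import Mathlib

open scoped symmDiff

/-- The `k`-subsets of the vertex set `[n]`. The element `i : Fin n` stands for the vertex `i + 1`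
of `[n] = {1, …, n}`. -/
abbrev KSubset (n k : ℕ) : Type := Set.powersetCard (Fin n) k

/-- The increasing enumeration of the elements of a `k`-subset. -/
abbrev KSubset.enum {n k : ℕ} (S : KSubset n k) : Fin k ↪o Fin n :=
  S.1.orderEmbOfFin (Set.powersetCard.card_eq S)

/-- The `k`-th compound matrix: its `(S, T)` entry is the minor of `A` with rows `S` and columns `T`,
both listed increasingly. -/
def compoundMatrix {R : Type*} [CommRing R] {n : ℕ} (k : ℕ) (A : Matrix (Fin n) (Fin n) R) :
    Matrix (KSubset n k) (KSubset n k) R :=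
  Matrix.of fun S T => (A.submatrix S.enum T.enum).det

/-- The field `ℚ(x_{i,j})` of rational functions in `n²` variables. -/
abbrev GenericField (n : ℕ) : Type := FractionRing (MvPolynomial (Fin n × Fin n) ℚ)

/-- The generic matrix `X = (x_{i,j})`, with entries in `ℚ(x_{i,j})`. -/
noncomputable def genericMatrix (n : ℕ) : Matrix (Fin n) (Fin n) (GenericField n) :=
  (Matrix.mvPolynomialX (Fin n) (Fin n) ℚ).map
    (algebraMap (MvPolynomial (Fin n × Fin n) ℚ) (GenericField n))

/-- `F₁` dominates `F₂`: the submatrix of `C_k(X)`, for the generic matrix `X`, with rows indexed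
by `F₂` and columns indexed by `F₁` has rank `|F₂|`. -/
def Dominates {n k : ℕ} (F₁ F₂ : Finset (KSubset n k)) : Prop :=
  ((compoundMatrix k (genericMatrix n)).submatrix
    (fun S : F₂ => (S : KSubset n k)) (fun T : F₁ => (T : KSubset n k))).rank = F₂.card

def WeaklyIsomorphic {n k : ℕ} (F₁ F₂ : Finset (KSubset n k)) : Prop :=
  Dominates F₁ F₂ ∧ Dominates F₂ F₁

/-- A term order on the `k`-subsets of `[n]`: a (strict) linear order extending the componentwise
partial order. -/
structure IsTermOrder {n k : ℕ} (r : KSubset n k → KSubset n k → Prop) : Prop where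
  isStrictTotalOrder : IsStrictTotalOrder (KSubset n k) r
  extends_componentwise : ∀ S T : KSubset n k, S ≠ T →
    (∀ i : Fin k, S.enum i ≤ T.enum i) → r S T

/-- `Y` is smaller than `Z` with respect to `r`: the `r`-least element of the symmetric difference
of `Y` and `Z` exists and belongs to `Y`. -/
def FamilyLT {α : Type*} [DecidableEq α] (r : α → α → Prop) (Y Z : Finset α) : Prop :=
  ∃ S ∈ Y ∆ Z, (∀ T ∈ Y ∆ Z, T ≠ S → r S T) ∧ S ∈ Y

/-- `H` is the `r`-smallest family of `k`-subsets of size `|F|` that is weakly isomorphic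
to `F` (with respect to the generic matrix). -/
def IsExteriorShifting {n k : ℕ} (r : KSubset n k → KSubset n k → Prop)
    (F H : Finset (KSubset n k)) : Prop :=
  (H.card = F.card ∧ WeaklyIsomorphic H F) ∧
    ∀ H' : Finset (KSubset n k), H'.card = F.card → WeaklyIsomorphic H' F → H' ≠ H →
      FamilyLT r H H'

theorem exists_familyLT_least {α : Type*} [Fintype α] [DecidableEq α] (r : α → α → Prop)
    (hr : IsStrictTotalOrder α r) (P : Finset α → Prop) (F : Finset α) (hF : P F) :
    ∃ H, P H ∧ ∀ H', P H' → H' ≠ H → FamilyLT r H H' := by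
  classical
  have := hr
  let : LinearOrder α := linearOrderOfSTO (Function.swap r)
  obtain ⟨H, hH, hmax⟩ := Finset.exists_max_image
    (Finset.univ.filter P) (fun s => toColex s) ⟨F, by simpa using hF⟩
  have hPH : P H := by simpa using hH
  refine ⟨H, hPH, fun H' hH' hne => ?_⟩
  have hlt : toColex H' < toColex H :=
    lt_of_le_of_ne (hmax H' (by simpa using hH')) (by simpa using hne)
  obtain ⟨hst, hm⟩ := Finset.Colex.toColex_lt_toColex_iff_max'_mem.1 hlt
  rw [FamilyLT, symmDiff_comm]
  have h1 : (H' ∆ H).max' (Finset.symmDiff_nonempty.2 hst) ∈ H' ∆ H := Finset.max'_mem _ _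
  refine ⟨_, h1, fun T hT hTne => ?_, ?_⟩
  · have : T < (H' ∆ H).max' (Finset.symmDiff_nonempty.2 hst) :=
      lt_of_le_of_ne (Finset.le_max' _ _ (by convert hT)) hTne
    exact this
  · convert hm

theorem compoundMatrix_map {R R' : Type*} [CommRing R] [CommRing R'] {n : ℕ} (k : ℕ)
    (f : R →+* R') (A : Matrix (Fin n) (Fin n) R) :
    compoundMatrix k (A.map f) = (compoundMatrix k A).map f := by
  ext S T
  simp [compoundMatrix, RingHom.map_det, Matrix.submatrix_map]

theorem compoundMatrix_one {R : Type*} [CommRing R] {n : ℕ} (k : ℕ) :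
    compoundMatrix k (1 : Matrix (Fin n) (Fin n) R) = 1 := by
  ext S T
  by_cases h : S = T
  · subst h
    rw [compoundMatrix, Matrix.of_apply, Matrix.submatrix_one _ S.enum.injective, Matrix.det_one,
      Matrix.one_apply_eq]
  · rw [Matrix.one_apply_ne h]
    obtain ⟨a, ha, hb⟩ := (Set.powersetCard.exists_mem_notMem_iff_ne S T).1 h
    have : a ∈ Set.range S.enum := by
      rw [Finset.range_orderEmbOfFin]; exact ha
    obtain ⟨i, hi⟩ := this
    refine Matrix.det_eq_zero_of_row_eq_zero i fun j => ?_
    rw [Matrix.submatrix_apply, hi, Matrix.one_apply_ne]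
    rintro rfl
    exact hb (Finset.orderEmbOfFin_mem T.1 (Set.powersetCard.card_eq T) j)

theorem dominates_refl {n k : ℕ} (F : Finset (KSubset n k)) : Dominates F F := by
  set P := Matrix.mvPolynomialX (Fin n) (Fin n) ℚ
  let M := (compoundMatrix k P).submatrix
    (fun S : F => (S : KSubset n k)) (fun S : F => (S : KSubset n k))
  have hM : M.det ≠ 0 := by
    intro h
    let f : MvPolynomial (Fin n × Fin n) ℚ →+* ℚ :=
      MvPolynomial.eval fun p => (1 : Matrix (Fin n) (Fin n) ℚ) p.1 p.2
    have hP : P.map f = 1 := Matrix.mvPolynomialX_mapMatrix_eval (1 : Matrix (Fin n) (Fin n) ℚ)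
    have h2 : f M.det = 1 := by
      rw [RingHom.map_det, RingHom.mapMatrix_apply, ← Matrix.submatrix_map,
        ← compoundMatrix_map, hP, compoundMatrix_one,
        Matrix.submatrix_one _ Subtype.val_injective, Matrix.det_one]
    rw [h, map_zero] at h2
    exact zero_ne_one h2
  have hdet : (M.map (algebraMap _ (GenericField n))).det ≠ 0 := by
    rw [← RingHom.mapMatrix_apply, ← RingHom.map_det]
    exact fun h => hM ((IsFractionRing.injective _ (GenericField n)) (by rw [h, map_zero]))
  have := Matrix.rank_of_isUnit _ ((Matrix.isUnit_iff_isUnit_det _).2 (isUnit_iff_ne_zero.2 hdet))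
  rw [Fintype.card_coe] at this
  rw [Dominates, genericMatrix, compoundMatrix_map, Matrix.submatrix_map]
  exact this

theorem exists_isExteriorShifting {n k : ℕ} (r : KSubset n k → KSubset n k → Prop)
    (hr : IsTermOrder r) (F : Finset (KSubset n k)) : ∃ H, IsExteriorShifting r F H := by
  obtain ⟨H, hH, h⟩ := exists_familyLT_least r hr.isStrictTotalOrder
    (fun H => H.card = F.card ∧ WeaklyIsomorphic H F) F
    ⟨rfl, dominates_refl F, dominates_refl F⟩
  exact ⟨H, hH, fun H' h1 h2 h3 => h H' ⟨h1, h2⟩ h3⟩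

/-- The exterior shifting of `F` with respect to the term order `r`. -/
noncomputable def exteriorShifting {n k : ℕ} (r : KSubset n k → KSubset n k → Prop)
    (hr : IsTermOrder r) (F : Finset (KSubset n k)) : Finset (KSubset n k) :=
  (exists_isExteriorShifting r hr F).choose

theorem exteriorShifting_spec {n k : ℕ} (r : KSubset n k → KSubset n k → Prop)
    (hr : IsTermOrder r) (F : Finset (KSubset n k)) :
    IsExteriorShifting r F (exteriorShifting r hr F) :=
  (exists_isExteriorShifting r hr F).choose_spec

theorem IsExteriorShifting.eq_exteriorShifting {n k : ℕ}
    {r : KSubset n k → KSubset n k → Prop} (hr : IsTermOrder r) {F H : Finset (KSubset n k)}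
    (hH : IsExteriorShifting r F H) : H = exteriorShifting r hr F := by
  have := hr.isStrictTotalOrder
  have hE := exteriorShifting_spec r hr F
  by_contra hne
  obtain ⟨S, hS, hSmin, hSH⟩ := hE.2 H hH.1.1 hH.1.2 hne
  obtain ⟨T, hT, hTmin, hTH⟩ := hH.2 _ hE.1.1 hE.1.2 (Ne.symm hne)
  rw [symmDiff_comm] at hT hTmin
  by_cases hST : S = T
  · subst hST
    rw [Finset.mem_symmDiff] at hS
    tauto
  · exact asymm_of r (hSmin T hT (Ne.symm hST)) (hTmin S hS hST)

/-- The sum of the elements of a subset of `[n] = {1, …, n}`; for an edge `ab` this is `a + b`. -/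
def labelSum {n k : ℕ} (S : KSubset n k) : ℕ := ∑ i ∈ S.1, ((i : ℕ) + 1)

open Classical in
/-- The edge set `E(G)` as a family of 2-subsets of `[n]`. -/
noncomputable def edgeFamily {n : ℕ} (G : SimpleGraph (Fin n)) : Finset (KSubset n 2) :=
  Finset.univ.filter fun S => ∃ a b : Fin n, G.Adj a b ∧ S.1 = {a, b}

/-- `B(n) = {ab : 1 ≤ a < b ≤ n, a + b ≤ n}`. -/
def familyB (n : ℕ) : Finset (KSubset n 2) :=
  Finset.univ.filter fun S => labelSum S ≤ n

/-! Full rank of a submatrix of the generic compound matrix follows from full rank at one rational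
point, so part 1 needs only vectors `f i` on the vertices whose wedges `f a ∧ f b`, for `ab` in
`B(n)`, stay independent when restricted to the edges of `G`. They are built by induction, deleting
a nonadjacent pair `u`, `v`: every other vertex is adjacent to `u` or `v`, so a first vector
supported on both, with equal values there, sees all remaining vertices
(`SimpleGraph.exists_generic_vectors`).

For part 2, the rows in `B(n)` extend to a row basis `H` weakly isomorphic to `E(G)`
(`exists_weaklyIsomorphic_superset`). As `B(n)` is an initial segment of the term order, a shifting
that missed one of its elements would not be smaller than `H`. -/

/-! ### Construction of the special vectors. -/

/-- A linearly independent family `f` for which the forms `f a ∧ f b`, `a + b + 2 ≤ m`, remain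
independent after restriction to the edges of a graph with no independent `3`-set. -/
theorem SimpleGraph.exists_generic_vectors {V : Type*} [DecidableEq V] (G : SimpleGraph V)
    (hG : ∀ S : Finset V, S.card = 3 → ∃ a ∈ S, ∃ b ∈ S, G.Adj a b) (m : ℕ) :
    ∀ s : Finset V, s.card = m → ∃ f : ℕ → V → ℚ,
      (∀ c : ℕ → ℚ, (∀ x ∈ s, ∑ i ∈ Finset.range m, c i * f i x = 0) → ∀ i < m, c i = 0) ∧
      ∀ c : ℕ → ℕ → ℚ, (∀ a b, c a b = -c b a) → (∀ a b, m < a + b + 2 → c a b = 0) →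
        (∀ x ∈ s, ∀ y ∈ s, G.Adj x y →
          ∑ a ∈ Finset.range m, ∑ b ∈ Finset.range m, c a b * f a x * f b y = 0) →
        ∀ a < m, ∀ b < m, c a b = 0 := by
  induction m using Nat.strong_induction_on with
  | _ m ih =>
  intro s hs
  -- On a complete graph the standard basis works; this includes `m ≤ 1`, so the induction needs no
  -- other base case.
  by_cases hc : ∀ x ∈ s, ∀ y ∈ s, x ≠ y → G.Adj x y
  · let e := s.equivFinOfCardEq hs
    let p : ∀ i < m, V := fun i hi => e.symm ⟨i, hi⟩
    have hp : ∀ i hi, p i hi ∈ s := fun i hi => (e.symm ⟨i, hi⟩).2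
    have hinj : ∀ i hi j hj, p i hi = p j hj ↔ i = j := by
      intro i hi j hj
      simp [p]
    let f : ℕ → V → ℚ := fun i x => if h : i < m then (if x = p i h then 1 else 0) else 0
    have hf : ∀ j hj, ∀ i, f i (p j hj) = if i = j then 1 else 0 := by
      intro j hj i
      by_cases hi : i < m
      · simp [f, hi, hinj, eq_comm]
      · have : i ≠ j := by omega
        simp [f, hi, this]
    refine ⟨f, fun c h i hi => ?_, fun c hsk _ h a ha b hb => ?_⟩
    · simpa [hf, hi] using h _ (hp i hi)
    · by_cases hab : a = b
      · subst hab
        linarith [hsk a a]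
      · have := h _ (hp a ha) _ (hp b hb) (hc _ (hp a ha) _ (hp b hb) (by simpa [hinj] using hab))
        simpa [hf, ha, hb] using this
  · push Not at hc
    obtain ⟨u, hu, v, hv, huv, hadj⟩ := hc
    have hv' : v ∈ s.erase u := Finset.mem_erase.2 ⟨huv.symm, hv⟩
    set t := (s.erase u).erase v with ht
    have hcard : t.card + 2 = m := by
      have h1 := Finset.card_erase_add_one hu
      have h2 := Finset.card_erase_add_one hv'
      rw [← ht] at h2
      omega
    obtain ⟨k, hk⟩ : ∃ k, k = t.card := ⟨_, rfl⟩
    rw [← hk] at hcard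
    subst hcard
    obtain ⟨f, hf1, hf2⟩ := ih k (by omega) t hk.symm
    have htu : ∀ w ∈ t, w ≠ u ∧ w ≠ v ∧ w ∈ s := by
      intro w hw
      simp only [ht, Finset.mem_erase] at hw
      tauto
    -- The old vectors are extended by zero and moved to the indices `1, …, k`. The new index `0`
    -- carries the indicator of `{u, v}`, the new index `k + 1` that of `{v}`.
    let g : ℕ → V → ℚ := fun i x =>
      if i = 0 then (if x = u ∨ x = v then 1 else 0)
      else if i = k + 1 then (if x = v then 1 else 0)
      else (if x = u ∨ x = v then 0 else f (i - 1) x)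
    have g0u : g 0 u = 1 := by simp [g]
    have g0v : g 0 v = 1 := by simp [g]
    have glu : g (k + 1) u = 0 := by simp [g, huv]
    have glv : g (k + 1) v = 1 := by simp [g]
    have gmu : ∀ i < k, g (i + 1) u = 0 := by
      intro i hi
      simp [g, hi.ne]
    have gmv : ∀ i < k, g (i + 1) v = 0 := by
      intro i hi
      simp [g, hi.ne]
    have g0t : ∀ w ∈ t, g 0 w = 0 := by
      intro w hw
      simp [g, htu w hw]
    have glt : ∀ w ∈ t, g (k + 1) w = 0 := by
      intro w hw
      simp [g, htu w hw]
    have gmt : ∀ i < k, ∀ w ∈ t, g (i + 1) w = f i w := by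
      intro i hi w hw
      simp [g, hi.ne, htu w hw]
    have hsum : ∀ φ : ℕ → ℚ, ∑ i ∈ Finset.range (k + 2), φ i =
        φ 0 + ∑ i ∈ Finset.range k, φ (i + 1) + φ (k + 1) := by
      intro φ
      rw [Finset.sum_range_succ, Finset.sum_range_succ', add_comm (φ 0)]
    have hsumu : ∀ c : ℕ → ℚ, ∑ i ∈ Finset.range (k + 2), c i * g i u = c 0 := by
      intro c
      rw [hsum, Finset.sum_eq_zero, g0u, glu]
      · ring
      · intro i hi
        rw [gmu i (Finset.mem_range.1 hi), mul_zero]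
    have hsumv : ∀ c : ℕ → ℚ, ∑ i ∈ Finset.range (k + 2), c i * g i v = c 0 + c (k + 1) := by
      intro c
      rw [hsum, Finset.sum_eq_zero, g0v, glv]
      · ring
      · intro i hi
        rw [gmv i (Finset.mem_range.1 hi), mul_zero]
    have hsumt : ∀ c : ℕ → ℚ, ∀ w ∈ t, ∑ i ∈ Finset.range (k + 2), c i * g i w =
        ∑ i ∈ Finset.range k, c (i + 1) * f i w := by
      intro c w hw
      rw [hsum, g0t w hw, glt w hw, mul_zero, mul_zero, zero_add, add_zero]
      exact Finset.sum_congr rfl fun i hi => by rw [gmt i (Finset.mem_range.1 hi) w hw]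
    have hcases : ∀ i < k + 2, i = 0 ∨ i = k + 1 ∨ ∃ j < k, i = j + 1 := by
      intro i hi
      rcases i with _ | j
      · exact Or.inl rfl
      · by_cases hj : j = k
        · exact Or.inr (Or.inl (by omega))
        · exact Or.inr (Or.inr ⟨j, by omega, rfl⟩)
    refine ⟨g, fun c h i hi => ?_, fun c hsk hsupp h => ?_⟩
    · have h0 : c 0 = 0 := by rw [← hsumu c, h u hu]
      have hl : c (k + 1) = 0 := by
        have := hsumv c
        rw [h v hv, h0] at this
        linarith
      have hm := hf1 (fun i => c (i + 1)) fun w hw => by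
        rw [← hsumt c w hw, h w (htu w hw).2.2]
      obtain rfl | rfl | ⟨j, hj, rfl⟩ := hcases i hi
      exacts [h0, hl, hm j hj]
    · have hW : ∀ x y, ∑ a ∈ Finset.range (k + 2), ∑ b ∈ Finset.range (k + 2),
          c a b * g a x * g b y = ∑ b ∈ Finset.range (k + 2),
            (∑ a ∈ Finset.range (k + 2), c a b * g a x) * g b y := by
        intro x y
        rw [Finset.sum_comm]
        simp_rw [Finset.sum_mul]
      -- The last vector is too late to occur in any admissible pair; it is there only to keep the
      -- family independent.
      have hl : ∀ b, c (k + 1) (b + 1) = 0 := fun b => hsupp _ _ (by omega)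
      -- Shifting both indices by one raises the sum by 2, exactly as `k` grows to `k + 2`, so the
      -- support condition passes to the middle block.
      have hmid : ∀ a < k, ∀ b < k, c (a + 1) (b + 1) = 0 := by
        refine hf2 (fun a b => c (a + 1) (b + 1)) (fun a b => hsk _ _)
          (fun a b hab => hsupp _ _ (by omega)) fun x hx y hy hxy => ?_
        have := h x (htu x hx).2.2 y (htu y hy).2.2 hxy
        rw [hW, hsumt _ y hy] at this
        rw [← this, Finset.sum_comm]
        refine Finset.sum_congr rfl fun b _ => ?_
        rw [hsumt _ x hx, Finset.sum_mul]
      -- An edge from `w` to `u` or to `v` yields the same equation, since row `k + 1` of `c`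
      -- vanishes here. Having it at every `w ∈ t`, independence of `f` applies.
      have h0 : ∀ b < k, c 0 (b + 1) = 0 := by
        refine hf1 (fun b => c 0 (b + 1)) fun w hw => ?_
        obtain ⟨hwu, hwv, hws⟩ := htu w hw
        have hor : G.Adj u w ∨ G.Adj v w := by
          obtain ⟨a, ha, b, hb, hab⟩ := hG {u, v, w}
            (Finset.card_eq_three.2 ⟨u, v, w, huv, hwu.symm, hwv.symm, rfl⟩)
          simp only [Finset.mem_insert, Finset.mem_singleton] at ha hb
          rcases ha with rfl | rfl | rfl <;> rcases hb with rfl | rfl | rfl <;>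
            first
            | exact (G.irrefl hab).elim
            | exact (hadj hab).elim
            | exact (hadj hab.symm).elim
            | exact Or.inl hab
            | exact Or.inl hab.symm
            | exact Or.inr hab
            | exact Or.inr hab.symm
        rcases hor with hw' | hw'
        · have := h u hu w hws hw'
          rw [hW, hsumt _ w hw] at this
          simpa only [hsumu] using this
        · have := h v hv w hws hw'
          rw [hW, hsumt _ w hw] at this
          simpa only [hsumv, hl, add_zero] using this
      have h00 : c 0 0 = 0 := by linarith [hsk 0 0]
      have h0l : c 0 (k + 1) = 0 := hsupp _ _ (by omega)
      intro a ha b hb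
      obtain rfl | rfl | ⟨i, hi, rfl⟩ := hcases a ha <;>
        obtain rfl | rfl | ⟨j, hj, rfl⟩ := hcases b hb
      · exact h00
      · exact h0l
      · exact h0 j hj
      · rw [hsk, h0l, neg_zero]
      · exact hl k
      · exact hl j
      · rw [hsk, h0 i hi, neg_zero]
      · rw [hsk, hl i, neg_zero]
      · exact hmid i hi j hj

/-! ### Domination as linear independence: specialization, symmetry, extension. -/

/-- The submatrix of the `k`-th compound matrix of `A` with rows `F₂` and columns `F₁`. -/
abbrev compoundSubmatrix {R : Type*} [CommRing R] {n k : ℕ} (A : Matrix (Fin n) (Fin n) R)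
    (F₁ F₂ : Finset (KSubset n k)) : Matrix F₂ F₁ R :=
  (compoundMatrix k A).submatrix
    (fun S : F₂ => (S : KSubset n k)) (fun T : F₁ => (T : KSubset n k))

theorem compoundSubmatrix_map {R R' : Type*} [CommRing R] [CommRing R'] {n k : ℕ}
    (f : R →+* R') (A : Matrix (Fin n) (Fin n) R) (F₁ F₂ : Finset (KSubset n k)) :
    compoundSubmatrix (A.map f) F₁ F₂ = (compoundSubmatrix A F₁ F₂).map f := by
  rw [compoundSubmatrix, compoundMatrix_map, Matrix.submatrix_map]

theorem compoundMatrix_transpose {R : Type*} [CommRing R] {n : ℕ} (k : ℕ)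
    (A : Matrix (Fin n) (Fin n) R) :
    compoundMatrix k A.transpose = (compoundMatrix k A).transpose := by
  ext S T
  simp [compoundMatrix, ← Matrix.transpose_submatrix, Matrix.det_transpose]

theorem dominates_iff_linearIndependent {n k : ℕ} (F₁ F₂ : Finset (KSubset n k)) :
    Dominates F₁ F₂ ↔
      LinearIndependent (GenericField n) (compoundSubmatrix (genericMatrix n) F₁ F₂).row := by
  rw [Dominates, Matrix.rank_eq_finrank_span_row, linearIndependent_iff_card_eq_finrank_span,
    Fintype.card_coe, eq_comm, Set.finrank]

theorem Matrix.exists_mul_eq_one_of_linearIndependent_row {K m l : Type*} [Field K] [Fintype m]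
    [DecidableEq m] [Fintype l] (M : Matrix m l K) (h : LinearIndependent K M.row) :
    ∃ N : Matrix l m K, M * N = 1 := by
  rw [← Matrix.mulVec_surjective_iff_exists_right_inverse]
  have : LinearMap.range M.mulVecLin = ⊤ := by
    apply Submodule.eq_top_of_finrank_eq
    rw [Module.finrank_fintype_fun_eq_card]
    exact h.rank_matrix
  exact LinearMap.range_eq_top.1 this

/-- A rational specialization certifies domination. -/
theorem dominates_of_specialization {n k : ℕ} (A : Matrix (Fin n) (Fin n) ℚ)
    (F₁ F₂ : Finset (KSubset n k)) (h : LinearIndependent ℚ (compoundSubmatrix A F₁ F₂).row) :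
    Dominates F₁ F₂ := by
  obtain ⟨N, hN⟩ := Matrix.exists_mul_eq_one_of_linearIndependent_row _ h
  set P := Matrix.mvPolynomialX (Fin n) (Fin n) ℚ
  let f : MvPolynomial (Fin n × Fin n) ℚ →+* ℚ := MvPolynomial.eval fun p => A p.1 p.2
  have hP : P.map f = A := Matrix.mvPolynomialX_mapMatrix_eval A
  -- The right inverse at the special point, taken with constant entries, gives a polynomial
  -- determinant with value 1 at that point, hence nonzero.
  let N' : Matrix F₁ F₂ (MvPolynomial (Fin n × Fin n) ℚ) := N.map MvPolynomial.C
  have hN' : N'.map f = N := by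
    ext i j
    simp [N', f]
  have hdet : (compoundSubmatrix P F₁ F₂ * N').det ≠ 0 := by
    intro h0
    have h1 : f (compoundSubmatrix P F₁ F₂ * N').det = 1 := by
      rw [RingHom.map_det, RingHom.mapMatrix_apply, Matrix.map_mul, hN', ← compoundSubmatrix_map,
        hP, hN, Matrix.det_one]
    rw [h0, map_zero] at h1
    exact zero_ne_one h1
  let ι := algebraMap (MvPolynomial (Fin n × Fin n) ℚ) (GenericField n)
  have hdet' : (compoundSubmatrix (genericMatrix n) F₁ F₂ * N'.map ι).det ≠ 0 := by
    rw [genericMatrix, compoundSubmatrix_map, ← Matrix.map_mul, ← RingHom.mapMatrix_apply,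
      ← RingHom.map_det]
    exact fun h => hdet ((IsFractionRing.injective _ (GenericField n)) (by rw [h, map_zero]))
  have hrank := Matrix.rank_of_isUnit _
    ((Matrix.isUnit_iff_isUnit_det _).2 (isUnit_iff_ne_zero.2 hdet'))
  rw [Fintype.card_coe] at hrank
  refine le_antisymm ?_ ?_
  · simpa using Matrix.rank_le_card_height (compoundSubmatrix (genericMatrix n) F₁ F₂)
  · rw [← hrank]
    exact Matrix.rank_mul_le_left _ _

/-- With equal sizes domination is nonvanishing of a square minor, and swapping `x_{i,j}` with
`x_{j,i}` is an injective substitution that transposes the compound matrix. -/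
theorem Dominates.symm_of_card_eq {n k : ℕ} {F₁ F₂ : Finset (KSubset n k)}
    (h : Dominates F₁ F₂) (hcard : F₁.card = F₂.card) : Dominates F₂ F₁ := by
  let e : F₂ ≃ F₁ := Finset.equivOfCardEq hcard.symm
  set P := Matrix.mvPolynomialX (Fin n) (Fin n) ℚ with hP
  let ι := algebraMap (MvPolynomial (Fin n × Fin n) ℚ) (GenericField n)
  have hι : Function.Injective ι := IsFractionRing.injective _ (GenericField n)
  have hrow := (dominates_iff_linearIndependent F₁ F₂).1 h
  have hunit : IsUnit ((compoundSubmatrix (genericMatrix n) F₁ F₂).submatrix id e) := by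
    rw [← Matrix.linearIndependent_rows_iff_isUnit]
    exact hrow.map' (LinearEquiv.funCongrLeft (GenericField n) (GenericField n) e).toLinearMap
      (LinearEquiv.ker _)
  have hdet : ((compoundSubmatrix P F₁ F₂).submatrix id e).det ≠ 0 := by
    intro h0
    rw [Matrix.isUnit_iff_isUnit_det, genericMatrix, compoundSubmatrix_map, Matrix.submatrix_map,
      ← RingHom.mapMatrix_apply, ← RingHom.map_det, h0, map_zero] at hunit
    exact not_isUnit_zero hunit
  let σ : MvPolynomial (Fin n × Fin n) ℚ →+* MvPolynomial (Fin n × Fin n) ℚ :=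
    (MvPolynomial.rename Prod.swap).toRingHom
  have hσ : Function.Injective σ := MvPolynomial.rename_injective _ Prod.swap_injective
  have hPσ : P.map σ = P.transpose := by
    ext1 i j
    simp [σ, hP, Matrix.mvPolynomialX]
  have hdet2 : ((compoundSubmatrix P F₂ F₁).submatrix e id).det ≠ 0 := by
    rw [← map_ne_zero_iff σ hσ, RingHom.map_det, RingHom.mapMatrix_apply, ← Matrix.submatrix_map,
      ← compoundSubmatrix_map, hPσ, compoundSubmatrix, compoundMatrix_transpose] at hdet
    rw [← Matrix.det_transpose]
    exact hdet
  have hdet3 : ((compoundSubmatrix (genericMatrix n) F₂ F₁).submatrix e id).det ≠ 0 := by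
    rw [genericMatrix, compoundSubmatrix_map, Matrix.submatrix_map, ← RingHom.mapMatrix_apply,
      ← RingHom.map_det]
    exact (map_ne_zero_iff ι hι).2 hdet2
  rw [dominates_iff_linearIndependent]
  have hrow2 := Matrix.linearIndependent_rows_iff_isUnit.2
    ((Matrix.isUnit_iff_isUnit_det _).2 (isUnit_iff_ne_zero.2 hdet3))
  exact (linearIndependent_equiv e).1 hrow2

/-- Restricted to the columns `F₁`, the rows have rank `F₁.card`, because `F₁` dominates itself. Any
independent set of rows therefore extends to a basis of that size. -/
theorem exists_weaklyIsomorphic_superset {n k : ℕ} {F₁ F₂ : Finset (KSubset n k)}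
    (h : Dominates F₁ F₂) :
    ∃ H, F₂ ⊆ H ∧ H.card = F₁.card ∧ WeaklyIsomorphic H F₁ := by
  classical
  let v : KSubset n k → F₁ → GenericField n :=
    fun S T => compoundMatrix k (genericMatrix n) S T
  have hv : ∀ F : Finset (KSubset n k), Dominates F₁ F ↔
      LinearIndepOn (GenericField n) v (F : Set (KSubset n k)) :=
    fun F => dominates_iff_linearIndependent F₁ F
  obtain ⟨b, -, hFb, hspan, hb⟩ := exists_linearIndepOn_extension ((hv F₂).1 h)
    (Set.subset_univ _)
  lift b to Finset (KSubset n k) using Set.toFinite b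
  have hdom : Dominates F₁ b := (hv b).2 hb
  have hle : ∀ F : Finset (KSubset n k), Dominates F₁ F → F.card ≤ F₁.card := by
    intro F hF
    rw [← hF]
    simpa using Matrix.rank_le_card_width (compoundSubmatrix (genericMatrix n) F₁ F)
  have hF₁ := (hv F₁).1 (dominates_refl F₁)
  have hcard : b.card = F₁.card := by
    refine le_antisymm (hle b hdom) ?_
    have h1 : Module.finrank (GenericField n)
        (Submodule.span (GenericField n) (v '' (F₁ : Set (KSubset n k)))) = F₁.card := by
      rw [Set.image_eq_range]
      simpa using finrank_span_eq_card hF₁.linearIndependent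
    have h2 : Module.finrank (GenericField n)
        (Submodule.span (GenericField n) (v '' (b : Set (KSubset n k)))) = b.card := by
      rw [Set.image_eq_range]
      simpa using finrank_span_eq_card hb.linearIndependent
    rw [← h1, ← h2]
    exact Submodule.finrank_mono
      (Submodule.span_le.2 ((Set.image_mono (Set.subset_univ _)).trans hspan))
  exact ⟨b, by exact_mod_cast hFb, hcard, hdom.symm_of_card_eq hcard.symm, hdom⟩

/-! ### The two claims about graphs. -/

theorem dominates_edgeFamily_familyB {n : ℕ} (G : SimpleGraph (Fin n))
    (hG : ∀ S : Finset (Fin n), S.card = 3 → ∃ a ∈ S, ∃ b ∈ S, G.Adj a b) :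
    Dominates (edgeFamily G) (familyB n) := by
  classical
  -- Independence of `f` itself is discarded: it serves only the induction.
  obtain ⟨f, -, hf⟩ := G.exists_generic_vectors hG n Finset.univ (by simp)
  refine dominates_of_specialization (Matrix.of fun i x => f i x) _ _ ?_
  rw [Fintype.linearIndependent_iff]
  intro g hg
  let p : familyB n → ℕ := fun S => (S : KSubset n 2).enum 0
  let q : familyB n → ℕ := fun S => (S : KSubset n 2).enum 1
  have hpq : ∀ S, p S < q S := fun S => (S : KSubset n 2).enum.strictMono (by decide)
  have hqn : ∀ S, q S < n := fun S => ((S : KSubset n 2).enum 1).2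
  have hset : ∀ S : KSubset n 2, S.1 = {S.enum 0, S.enum 1} := by
    intro S
    ext x
    have := Set.ext_iff.1 (Finset.range_orderEmbOfFin S.1 (Set.powersetCard.card_eq S)) x
    rw [← Finset.mem_coe, ← this, Set.mem_range, Fin.exists_fin_two, Finset.mem_insert,
      Finset.mem_singleton, @eq_comm _ x (S.enum 0), @eq_comm _ x (S.enum 1)]
  have hinj : ∀ S T, p S = p T → q S = q T → S = T := by
    intro S T h1 h2
    apply Subtype.ext
    apply Subtype.ext
    rw [hset, hset, Fin.ext h1, Fin.ext h2]
  -- The 2 comes from vertices being labelled from 1 but indexed from 0.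
  have hsum : ∀ S, p S + q S + 2 ≤ n := by
    intro S
    have h1 : labelSum (S : KSubset n 2) ≤ n := (Finset.mem_filter.1 S.2).2
    rw [labelSum, hset, Finset.sum_pair (by
      intro h
      exact (hpq S).ne (congrArg Fin.val h))] at h1
    simp only [p, q]
    omega
  -- A row relation `g` is encoded as a skew-symmetric array, so that the 2-minors become the
  -- bilinear form in `hf`.
  let c : ℕ → ℕ → ℚ := fun a b => ∑ S, g S *
    ((if a = p S then 1 else 0) * (if b = q S then 1 else 0) -
      (if a = q S then 1 else 0) * (if b = p S then 1 else 0))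
  have hδδ : ∀ a b i j : ℕ, ¬ (a = i ∧ b = j) →
      (if a = i then (1 : ℚ) else 0) * (if b = j then 1 else 0) = 0 := by
    intro a b i j h
    rw [ite_mul, one_mul, zero_mul, ← ite_and, if_neg h]
  have hc : ∀ S, c (p S) (q S) = g S := by
    intro S
    simp only [c]
    rw [Finset.sum_eq_single S]
    · simp [(hpq S).ne]
    · intro T _ hT
      have h1 := hpq S
      have h2 := hpq T
      have h3 : ¬ (p S = p T ∧ q S = q T) := fun h => hT (hinj S T h.1 h.2).symm
      have h4 : ¬ (p S = q T ∧ q S = p T) := by omega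
      rw [hδδ _ _ _ _ h3, hδδ _ _ _ _ h4]
      simp
    · simp
  intro S
  rw [← hc S]
  refine hf c ?_ ?_ ?_ _ ((hpq S).trans (hqn S)) _ (hqn S)
  · intro a b
    simp only [c, ← Finset.sum_neg_distrib]
    exact Finset.sum_congr rfl fun S _ => by ring
  · intro a b hab
    refine Finset.sum_eq_zero fun S _ => ?_
    have := hsum S
    have h3 : ¬ (a = p S ∧ b = q S) := by omega
    have h4 : ¬ (a = q S ∧ b = p S) := by omega
    rw [hδδ _ _ _ _ h3, hδδ _ _ _ _ h4]
    simp
  · intro x _ y _ hxy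
    have key : ∀ x y : Fin n, ∑ a ∈ Finset.range n, ∑ b ∈ Finset.range n, c a b * f a x * f b y =
        ∑ S, g S * (f (p S) x * f (q S) y - f (q S) x * f (p S) y) := by
      intro x y
      have hδ : ∀ i < n, ∀ z, ∑ a ∈ Finset.range n, (if a = i then (1 : ℚ) else 0) * f a z =
          f i z := by
        intro i hi z
        simp [hi]
      simp only [c, Finset.sum_mul]
      have : ∀ a b, ∀ S, g S * ((if a = p S then (1 : ℚ) else 0) * (if b = q S then 1 else 0) -
          (if a = q S then 1 else 0) * (if b = p S then 1 else 0)) * f a x * f b y =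
          g S * (((if a = p S then (1 : ℚ) else 0) * f a x) * ((if b = q S then 1 else 0) * f b y) -
          ((if a = q S then 1 else 0) * f a x) * ((if b = p S then 1 else 0) * f b y)) := by
        intros
        ring
      simp_rw [this]
      rw [Finset.sum_congr rfl fun a _ => Finset.sum_comm, Finset.sum_comm]
      refine Finset.sum_congr rfl fun S _ => ?_
      simp_rw [← Finset.mul_sum, Finset.sum_sub_distrib, ← Finset.mul_sum, ← Finset.sum_mul]
      rw [hδ _ (hqn S), hδ _ (hqn S), hδ _ ((hpq S).trans (hqn S)), hδ _ ((hpq S).trans (hqn S))]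
    have hE : ∀ T ∈ edgeFamily G, ∑ S, g S * (f (p S) (T.enum 0) * f (q S) (T.enum 1) -
        f (q S) (T.enum 0) * f (p S) (T.enum 1)) = 0 := by
      intro T hT
      have := congrFun hg ⟨T, hT⟩
      simp only [Finset.sum_apply, Pi.smul_apply, smul_eq_mul, Pi.zero_apply] at this
      rw [← this]
      refine Finset.sum_congr rfl fun S _ => ?_
      simp [Matrix.row, compoundMatrix, Matrix.det_fin_two, p, q]
      left
      ring
    have hxy' : ({x, y} : Finset (Fin n)).card = 2 := Finset.card_pair hxy.ne
    let T : KSubset n 2 := ⟨{x, y}, hxy'⟩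
    have hT := hE T (by
      rw [edgeFamily, Finset.mem_filter]
      exact ⟨Finset.mem_univ _, x, y, hxy, rfl⟩)
    have hne : T.enum 0 ≠ T.enum 1 := fun h => by simpa using T.enum.injective h
    have hTs : ({x, y} : Finset (Fin n)) = {T.enum 0, T.enum 1} := hset T
    rw [key]
    have hx : x ∈ ({T.enum 0, T.enum 1} : Finset (Fin n)) := by rw [← hTs]; simp
    have hy : y ∈ ({T.enum 0, T.enum 1} : Finset (Fin n)) := by rw [← hTs]; simp
    simp only [Finset.mem_insert, Finset.mem_singleton] at hx hy
    rcases hx with hx | hx <;> rcases hy with hy | hy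
    · exact (hxy.ne (hx.trans hy.symm)).elim
    · rw [hx, hy]
      exact hT
    -- Here `x`, `y` are in decreasing order, which only flips the sign of the minor.
    · rw [hx, hy, ← neg_eq_zero, ← Finset.sum_neg_distrib, ← hT]
      exact Finset.sum_congr rfl fun S _ => by ring
    · exact (hxy.ne (hx.trans hy.symm)).elim

theorem theorem1p3 (n : ℕ) (G : SimpleGraph (Fin n))
    (hG : ∀ S : Finset (Fin n), S.card = 3 → ∃ a ∈ S, ∃ b ∈ S, G.Adj a b) :
    Dominates (edgeFamily G) (familyB n) ∧
      ∀ (r : KSubset n 2 → KSubset n 2 → Prop) (hr : IsTermOrder r),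
        (∀ S T : KSubset n 2, labelSum S < labelSum T → r S T) →
          familyB n ⊆ exteriorShifting r hr (edgeFamily G) := by
  have hdom := dominates_edgeFamily_familyB G hG
  refine ⟨hdom, fun r hr hsum T hT => ?_⟩
  have := hr.isStrictTotalOrder
  by_contra hTH
  obtain ⟨H, hBH, hcard, hH⟩ := exists_weaklyIsomorphic_superset hdom
  obtain ⟨S, hS, hmin, hSH⟩ := (exteriorShifting_spec r hr (edgeFamily G)).2 H hcard hH (by
    rintro rfl
    exact hTH (hBH hT))
  have hST : T ≠ S := by
    rintro rfl
    exact hTH hSH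
  have hrST := hmin T (Finset.mem_symmDiff.2 (Or.inr ⟨hBH hT, hTH⟩)) hST
  -- `S` precedes `T` in an order refining the sum, so `S` lies in `B(n) ⊆ H`; but `S` is also in
  -- the shifting, hence not in the symmetric difference.
  have hle : labelSum S ≤ labelSum T := by
    by_contra! hlt
    exact asymm_of r hrST (hsum T S hlt)
  have hSB : S ∈ familyB n :=
    Finset.mem_filter.2 ⟨Finset.mem_univ _, hle.trans (Finset.mem_filter.1 hT).2⟩
  rw [Finset.mem_symmDiff] at hS
  have := hBH hSB
  tauto
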